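/- Let $G$ be a finite group and let $N$ be a normal subgroup of $G$. A $G$-class of $N$ is a conjugacy class of $G$ contained in $N$. Let $\Gamma_G(N)$ be the graph whose vertices are the $G$-classes of $N$ of cardinality greater than $1$, two distinct vertices being joined by an edge if and only if their cardinalities are not coprime. Suppose that $\Gamma_G(N)$ has exactly two vertices and one edge. Then one of the following holds: 1. $N$ is a $p$-group for some prime $p$. 2. $N = P \times Q$ (an internal direct product), where, for some odd prime $p$, $P$ is a $p$-group such that $P/(\mathbf{Z}(G)\cap P)$ is an elementary abelian $p$-group, and $Q \subseteq \mathbf{Z}(G)\cap N$ with $Q \cong \mathbb{Z}_2$. 3. For some distinct primes $p$ and $q$, $N$ is a Frobenius group whose kernel $K$ is an elementary abelian $p$-group and whose complement $H$ is isomorphic to $\mathbb{Z}_q$. Moreover, $|N| = p^a q$ for some integer $a \geq 1$, and the set of cardinalities of the $G$-classes of $N$ is $\{1,\ p^a-1,\ p^a(q-1)\}$. -/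

import Mathlib

namespace NormalClassGraph

/-- The `G`-classes of the subgroup `N`: the conjugacy classes of `G` that are contained in `N`. -/
def classesIn {G : Type*} [Group G] (N : Subgroup G) : Set (ConjClasses G) :=
  {c | c.carrier ⊆ (N : Set G)}

/-- The vertices of `Γ_G(N)`: the `G`-classes of `N` of cardinality bigger than `1`. -/
abbrev Vertex {G : Type*} [Group G] (N : Subgroup G) : Type _ :=
  {c : ConjClasses G // c ∈ classesIn N ∧ 1 < Nat.card c.carrier}

/-- The graph `Γ_G(N)`: two distinct vertices are joined by an edge if their cardinalities
are not coprime. -/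
def graph {G : Type*} [Group G] (N : Subgroup G) : SimpleGraph (Vertex N) where
  Adj c d := c ≠ d ∧ ¬ Nat.Coprime (Nat.card c.1.carrier) (Nat.card d.1.carrier)
  symm := ⟨fun _ _ h => ⟨h.1.symm, fun h' => h.2 h'.symm⟩⟩
  loopless := ⟨fun _ h => h.1 rfl⟩

/-- `A` is an elementary abelian `p`-group (the trivial group is allowed). -/
def IsElementaryAbelian (p : ℕ) (A : Type*) [Group A] : Prop :=
  (∀ x y : A, x * y = y * x) ∧ ∀ x : A, x ^ p = 1

/-- `N` is the internal direct product of its subgroups `P` and `Q`. -/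
structure IsInternalDirectProduct {G : Type*} [Group G] (N P Q : Subgroup G) : Prop where
  disjoint : P ⊓ Q = ⊥
  sup_eq : P ⊔ Q = N
  commute : ∀ x ∈ P, ∀ y ∈ Q, x * y = y * x

/-- `A` is a Frobenius group with kernel `K` and complement `H`: `H` is a nontrivial proper
subgroup that meets each of its conjugates by elements outside `H` trivially, and `K` consists of
the identity and the elements which lie in no conjugate of `H`. -/
structure IsFrobenius {A : Type*} [Group A] (K H : Subgroup A) : Prop where
  complement_ne_bot : H ≠ ⊥
  complement_ne_top : H ≠ ⊤
  inter_conj : ∀ g : A, g ∉ H → ∀ h ∈ H, g⁻¹ * h * g ∈ H → h = 1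
  mem_kernel_iff : ∀ x : A, x ∈ K ↔ x = 1 ∨ ∀ g : A, g⁻¹ * x * g ∉ H

end NormalClassGraph

namespace NormalClassGraph

open Subgroup

/-! Suppose that $N$ is not of prime power order. The two-vertex hypothesis is used in this form:
two non-conjugate noncentral elements of $N$ represent all its noncentral classes.

If $N$ has a noncentral $p$-element $a$ and a central $p'$-element $y \neq 1$, then $a$ and $ay$ are
such representatives. This leaves $1$ and $y$ as the only central $p'$-elements of $N$, so $y$ is an
involution and $p$ is odd. For each $x \in N$, one of $x$, $xy$ is a $p$-element, so $N/\langle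
y\rangle$ is a $p$-group and Schur–Zassenhaus splits off $\langle y\rangle$. The noncentral elements
of the other factor are all conjugate, which makes its central quotient elementary abelian.

If no such pair exists, comparing two primes gives $Z(G) \cap N = 1$, and $N \setminus \{1\}$
consists of one class of elements of prime order $p$ and one of prime order $q$. Conjugation by $G$
makes $\mathrm{Aut}(N)$ transitive on each. A count of elements lying in centres of Sylow subgroups,
with Burnside's transfer theorem, makes one of the two sets, together with $1$, a normal subgroup
$K$ (`exists_normal_mem_iff_orderOf_eq`). Transitivity makes $K$ abelian, and a norm computation
shows that a Sylow subgroup for the other prime has prime order, since a group $\mathbb{Z}_q \times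
\mathbb{Z}_q$ cannot act fixed-point-freely on $K$. -/

/-- Any two elements of order `p` are exchanged by an automorphism. -/
def AutTransitive (p : ℕ) (M : Type*) [Group M] : Prop :=
  ∀ x y : M, orderOf x = p → orderOf y = p → ∃ φ : MulAut M, φ x = y

/-! ### Counting elements of prime order through Sylow centres. -/

section AutTransitive

variable {M : Type*} [Group M] [Finite M] {p q : ℕ} [hp : Fact p.Prime] [hq : Fact q.Prime]

theorem exists_orderOf_eq_mem_center (P : Sylow p M) (hdvd : p ∣ Nat.card M) :
    ∃ w : M, orderOf w = p ∧ w ∈ P ∧ w ∈ centralizer (P : Set M) := by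
  have hPp : p ∣ Nat.card P := P.dvd_card_of_dvd_card hdvd
  have : Nontrivial P := by
    rw [← Finite.one_lt_card_iff_nontrivial]
    exact hp.out.one_lt.trans_le (Nat.le_of_dvd Nat.card_pos hPp)
  have hc := P.2.center_nontrivial
  have hcp : IsPGroup p (center P) := P.2.to_subgroup _
  obtain ⟨n, hn, hcard⟩ := hcp.nontrivial_iff_card.1 hc
  obtain ⟨w, hw⟩ := exists_prime_orderOf_dvd_card' (G := center P) p
    (hcard ▸ dvd_pow_self p hn.ne')
  refine ⟨((w : P) : M), by rwa [orderOf_coe, orderOf_coe], (w : P).2, ?_⟩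
  rw [mem_centralizer_iff]
  intro u hu
  exact congrArg Subtype.val (mem_center_iff.1 w.2 ⟨u, hu⟩)

/-- Some element of order $p$ is central in a Sylow subgroup, so by transitivity every one is. Each
of the $n_p$ Sylow centres holds at most $|Z(P)| - 1$ of them. -/
theorem card_orderOf_eq_add_card_sylow_le (h : AutTransitive p M) (P : Sylow p M) :
    Nat.card {x : M // orderOf x = p} + Nat.card (Sylow p M) ≤
      Nat.card (Sylow p M) * Nat.card (P ⊓ centralizer (P : Set M) : Subgroup M) := by
  choose g hg using fun S : Sylow p M => MulAction.exists_smul_eq M P S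
  have key : ∀ x : {x : M // orderOf x = p}, ∃ S : Sylow p M,
      ∃ w : (P ⊓ centralizer (P : Set M) : Subgroup M), g S * w * (g S)⁻¹ = x.1 := by
    rintro ⟨x, hx⟩
    obtain ⟨w, hwo, hwP, hwc⟩ := exists_orderOf_eq_mem_center P (hx ▸ orderOf_dvd_natCard x)
    obtain ⟨φ, rfl⟩ := h w x hwo hx
    have hmem : ∀ y : M, y ∈ φ • P ↔ φ⁻¹ y ∈ P := by
      intro y
      exact Subgroup.mem_pointwise_smul_iff_inv_smul_mem
    have hmem' : ∀ y : M, y ∈ φ • P ↔ (g (φ • P))⁻¹ * y * g (φ • P) ∈ P := by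
      intro y
      conv_lhs => rw [← hg (φ • P)]
      refine (Subgroup.mem_pointwise_smul_iff_inv_smul_mem (S := (P : Subgroup M))
        (a := MulAut.conj (g (φ • P)))).trans ?_
      rw [← map_inv]
      simp
      rfl
    refine ⟨φ • P, ⟨(g (φ • P))⁻¹ * φ w * g (φ • P), ?_, ?_⟩, by group⟩
    · exact (hmem' _).1 ((hmem _).2 (by simpa using hwP))
    · refine mem_centralizer_iff.2 ?_
      intro u hu
      have h1 : g (φ • P) * u * (g (φ • P))⁻¹ ∈ φ • P := (hmem' _).2 (by simpa [mul_assoc] using hu)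
      have h2 := mem_centralizer_iff.1 hwc _ ((hmem _).1 h1)
      have h3 := congrArg φ h2
      simp only [map_mul, MulAut.apply_inv_self] at h3
      calc u * ((g (φ • P))⁻¹ * φ w * g (φ • P))
          = (g (φ • P))⁻¹ * (g (φ • P) * u * (g (φ • P))⁻¹ * φ w) * g (φ • P) := by group
        _ = (g (φ • P))⁻¹ * φ w * g (φ • P) * u := by rw [h3]; group
  choose S w hw using key
  rw [← Nat.card_sum, ← Nat.card_prod]
  -- The pairs $(T, 1)$ account for the identity of each Sylow centre and give the summand $n_p$.
  refine Nat.card_le_card_of_injective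
    (Sum.elim (fun x => (S x, w x)) (fun T => (T, 1))) ?_
  have hne : ∀ x, w x ≠ 1 := by
    intro x hx
    have h1 := hw x
    rw [hx] at h1
    have h2 := x.2
    rw [← h1] at h2
    simp only [OneMemClass.coe_one, mul_one, mul_inv_cancel, orderOf_one] at h2
    exact hp.out.one_lt.ne h2
  rintro (x | T) (y | U) hxy
  · simp only [Sum.elim_inl, Prod.mk.injEq] at hxy
    exact congrArg _ (Subtype.ext (by rw [← hw x, ← hw y, hxy.1, hxy.2]))
  · simp only [Sum.elim_inl, Sum.elim_inr, Prod.mk.injEq] at hxy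
    exact absurd hxy.2 (hne x)
  · simp only [Sum.elim_inl, Sum.elim_inr, Prod.mk.injEq] at hxy
    exact absurd hxy.2.symm (hne y)
  · simp only [Sum.elim_inr, Prod.mk.injEq] at hxy
    rw [hxy.1]

/-- Since $n_p \le [M:P]$ and $|Z(P)| \le |P|$, equality of the products makes $P$ abelian and
self-normalizing, and Burnside's transfer theorem applies. -/
theorem exists_normal_isComplement_of_card_eq (P : Sylow p M)
    (h : Nat.card (Sylow p M) * Nat.card (P ⊓ centralizer (P : Set M) : Subgroup M) =
      Nat.card M) :
    ∃ R : Subgroup M, R.Normal ∧ R.IsComplement' P := by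
  have h1 : Nat.card (Sylow p M) ≤ (P : Subgroup M).index :=
    Nat.le_of_dvd (Nat.pos_of_ne_zero index_ne_zero_of_finite) P.card_dvd_index
  have h2 : Nat.card (P ⊓ centralizer (P : Set M) : Subgroup M) ≤ Nat.card P :=
    card_le_of_le inf_le_left
  have h3 := (P : Subgroup M).index_mul_card
  have hP0 : 0 < Nat.card P := Nat.card_pos
  have hS0 : 0 < Nat.card (Sylow p M) := Nat.card_pos
  have h4 : Nat.card (Sylow p M) = (P : Subgroup M).index := by
    refine le_antisymm h1 ?_
    refine Nat.le_of_mul_le_mul_right (c := Nat.card P) ?_ hP0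
    rw [h3, ← h]
    exact Nat.mul_le_mul_left _ h2
  have h5 : Nat.card (P ⊓ centralizer (P : Set M) : Subgroup M) = Nat.card P := by
    refine Nat.eq_of_mul_eq_mul_left hS0 ?_
    rw [h, h4, h3]
  have h6 : (P : Subgroup M) ≤ centralizer (P : Set M) := by
    rw [← inf_eq_left]
    exact eq_of_le_of_card_ge inf_le_left h5.ge
  have h7 : (P : Subgroup M) = normalizer (P : Set M) := by
    refine eq_of_le_of_card_ge le_normalizer ?_
    rw [P.card_eq_index_normalizer] at h4
    have h8 := (normalizer (P : Set M)).index_mul_card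
    rw [h4] at h8
    exact (Nat.eq_of_mul_eq_mul_left (Nat.pos_of_ne_zero index_ne_zero_of_finite)
      (h8.trans h3.symm)).le
  exact ⟨_, MonoidHom.normal_ker _,
    MonoidHom.ker_transferSylow_isComplement' P (h7.symm.le.trans h6)⟩

theorem mem_iff_orderOf_eq_of_isComplement (hpq : p ≠ q)
    (hord : ∀ x : M, x = 1 ∨ orderOf x = p ∨ orderOf x = q) (P : Sylow p M)
    (R : Subgroup M) [R.Normal] (hR : R.IsComplement' P) (x : M) :
    x ∈ R ↔ x = 1 ∨ orderOf x = q := by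
  have hcop : (Nat.card P).Coprime (Nat.card R) := by
    rw [← hR.index_eq_card]; exact P.card_coprime_index
  constructor
  · intro hx
    rcases hord x with h | h | h
    · exact Or.inl h
    · exfalso
      have h1 : p ∣ Nat.card R := by
        rw [← h, ← orderOf_mk x hx]; exact orderOf_dvd_natCard _
      have h2 : p ∣ Nat.card P := P.dvd_card_of_dvd_card (h ▸ orderOf_dvd_natCard x)
      exact hp.out.one_lt.ne' (Nat.dvd_one.1 (hcop ▸ Nat.dvd_gcd h2 h1))
    · exact Or.inr h
  · rintro (rfl | h)
    · exact one_mem R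
    · rw [← QuotientGroup.eq_one_iff, ← orderOf_eq_one_iff]
      obtain ⟨n, hn⟩ := IsPGroup.iff_card.1 P.2
      have h1 : orderOf (x : M ⧸ R) ∣ q := h ▸ orderOf_map_dvd (QuotientGroup.mk' R) x
      have h2 : orderOf (x : M ⧸ R) ∣ p ^ n := by
        rw [← hn, ← hR.symm.index_eq_card]; exact orderOf_dvd_natCard _
      exact Nat.eq_one_of_dvd_coprimes
        (((Nat.coprime_primes hq.out hp.out).2 hpq.symm).pow_right n) h1 h2

/-- Both $n_p|Z(P)|$ and $n_q|Z(Q)|$ divide $|M|$. If both are proper divisors, each is at most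
$|M|/2$, and the count gives $|M| \le 1 + |M| - n_p - n_q$, which is absurd. If one equals $|M|$,
its Sylow subgroup has a normal complement. -/
theorem exists_normal_mem_iff_orderOf_eq (hpq : p ≠ q)
    (hord : ∀ x : M, x = 1 ∨ orderOf x = p ∨ orderOf x = q)
    (h_p : AutTransitive p M) (h_q : AutTransitive q M) :
    (∃ R : Subgroup M, R.Normal ∧ ∀ x, x ∈ R ↔ x = 1 ∨ orderOf x = p) ∨
      ∃ R : Subgroup M, R.Normal ∧ ∀ x, x ∈ R ↔ x = 1 ∨ orderOf x = q := by
  obtain ⟨P⟩ : Nonempty (Sylow p M) := inferInstance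
  obtain ⟨Q⟩ : Nonempty (Sylow q M) := inferInstance
  have hP := card_orderOf_eq_add_card_sylow_le h_p P
  have hQ := card_orderOf_eq_add_card_sylow_le h_q Q
  have hdvd : ∀ {r : ℕ} [Fact r.Prime] (S : Sylow r M),
      Nat.card (Sylow r M) * Nat.card (S ⊓ centralizer (S : Set M) : Subgroup M) ∣ Nat.card M := by
    intro r _ S
    rw [← (S : Subgroup M).index_mul_card]
    exact mul_dvd_mul S.card_dvd_index (card_dvd_of_le inf_le_left)
  have hcard : Nat.card M ≤
      1 + (Nat.card {x : M // orderOf x = p} + Nat.card {x : M // orderOf x = q}) := by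
    have : Nat.card M ≤ Nat.card (Unit ⊕ ({x : M // orderOf x = p} ⊕ {x : M // orderOf x = q})) :=
      Nat.card_le_card_of_surjective
        (Sum.elim (fun _ => 1) (Sum.elim Subtype.val Subtype.val)) (by
          intro x
          rcases hord x with h | h | h
          · exact ⟨Sum.inl (), h.symm⟩
          · exact ⟨Sum.inr (Sum.inl ⟨x, h⟩), rfl⟩
          · exact ⟨Sum.inr (Sum.inr ⟨x, h⟩), rfl⟩)
    simpa [Nat.card_sum] using this
  have hp0 : 0 < Nat.card (Sylow p M) := Nat.card_pos
  have hq0 : 0 < Nat.card (Sylow q M) := Nat.card_pos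
  obtain ⟨s, hs⟩ := hdvd P
  obtain ⟨t, ht⟩ := hdvd Q
  have hM : 0 < Nat.card M := Nat.card_pos
  by_cases hs1 : s = 1
  · right
    obtain ⟨R, hR, hc⟩ := exists_normal_isComplement_of_card_eq P (by rw [hs, hs1, mul_one])
    exact ⟨R, hR, mem_iff_orderOf_eq_of_isComplement hpq hord P R hc⟩
  by_cases ht1 : t = 1
  · left
    obtain ⟨R, hR, hc⟩ := exists_normal_isComplement_of_card_eq Q (by rw [ht, ht1, mul_one])
    exact ⟨R, hR, mem_iff_orderOf_eq_of_isComplement hpq.symm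
      (fun x => (hord x).imp_right Or.symm) Q R hc⟩
  exfalso
  have hs2 : 2 ≤ s := by
    rcases s with _ | _ | s
    · omega
    · omega
    · omega
  have ht2 : 2 ≤ t := by
    rcases t with _ | _ | t
    · omega
    · omega
    · omega
  have e1 := Nat.mul_le_mul_left
    (Nat.card (Sylow p M) * Nat.card (P ⊓ centralizer (P : Set M) : Subgroup M)) hs2
  have e2 := Nat.mul_le_mul_left
    (Nat.card (Sylow q M) * Nat.card (Q ⊓ centralizer (Q : Set M) : Subgroup M)) ht2
  rw [← hs] at e1
  rw [← ht] at e2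
  omega

end AutTransitive

/-! ### Norms of fixed-point-free automorphisms. -/

/-- An automorphism of order dividing `n` with no nontrivial fixed point has trivial norm. -/
theorem prod_pow_apply_eq_one {K : Type*} [CommGroup K] (U : MulAut K) (n : ℕ) (hU : U ^ n = 1)
    (hfix : ∀ k, U k = k → k = 1) (k : K) : ∏ j ∈ Finset.range n, (U ^ j) k = 1 := by
  -- Applying `U` permutes the factors cyclically, so the product is a fixed point.
  apply hfix
  have h1 := Finset.prod_range_succ (fun j => (U ^ j) k) n
  have h2 := Finset.prod_range_succ' (fun j => (U ^ j) k) n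
  rw [h1] at h2
  simp only [hU, pow_zero, MulAut.one_apply, mul_left_inj] at h2
  rw [map_prod, h2]
  simp only [pow_succ', MulAut.mul_apply]

/-- Multiply the norms of all $XY^i$, each trivial, and regroup by the exponent $j$: the terms with
$j = 0$ give $k^q$, and those with $j \neq 0$ form the norm of $Y^j$ at $X^j k$, again trivial. -/
theorem pow_eq_one_of_fixedPointFree {K : Type*} [CommGroup K] {q : ℕ} (hq : q.Prime)
    (X Y : MulAut K) (hcomm : Commute X Y) (hX : X ^ q = 1) (hY : Y ^ q = 1)
    (hfixY : ∀ k, Y k = k → k = 1) (hfix : ∀ i k, (X * Y ^ i) k = k → k = 1) (k : K) :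
    k ^ q = 1 := by
  have h1 : ∀ i, ∏ j ∈ Finset.range q, ((X * Y ^ i) ^ j) k = 1 := fun i =>
    prod_pow_apply_eq_one _ q (by
      rw [(hcomm.pow_right i).mul_pow, hX, ← pow_mul, mul_comm i, pow_mul, hY, one_pow, one_mul])
      (hfix i) k
  have h2 : ∏ j ∈ Finset.range q, ∏ i ∈ Finset.range q, ((X * Y ^ i) ^ j) k = 1 := by
    rw [Finset.prod_comm]
    exact Finset.prod_eq_one fun i _ => h1 i
  rw [Finset.prod_eq_single_of_mem 0 (Finset.mem_range.2 hq.pos)] at h2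
  · simpa using h2
  · intro j hj hj0
    have hco : Nat.Coprime j q :=
      (Nat.coprime_of_lt_prime hj0 (Finset.mem_range.1 hj) hq).symm
    have h3 := prod_pow_apply_eq_one (Y ^ j) q
      (by rw [← pow_mul, mul_comm, pow_mul, hY, one_pow]) (by
        intro k hk
        apply hfixY
        -- $Y$ is a power of $Y^j$, so every fixed point of $Y^j$ is fixed by $Y$.
        obtain ⟨l, -, hl⟩ := Nat.exists_mul_mod_eq_one_of_coprime hco hq.one_lt
        have h4 : (Y ^ j) ^ l = Y := by
          rw [← pow_mul, ← pow_mod_orderOf]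
          have : (j * l) % orderOf Y = 1 % orderOf Y := by
            have h5 : j * l ≡ 1 [MOD q] := by
              rw [Nat.ModEq, hl, Nat.mod_eq_of_lt hq.one_lt]
            exact h5.of_dvd (orderOf_dvd_of_pow_eq_one hY)
          rw [this, pow_mod_orderOf, pow_one]
        have h6 : ∀ m : ℕ, ((Y ^ j) ^ m) k = k := by
          intro m
          induction m with
          | zero => simp
          | succ m ih => rw [pow_succ, MulAut.mul_apply, hk, ih]
        rw [← h6 l]
        conv_lhs => rw [h6 l]
        conv_rhs => rw [h4]) ((X ^ j) k)
    rw [← h3]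
    refine Finset.prod_congr rfl fun i _ => ?_
    rw [(hcomm.pow_right i).mul_pow, ← pow_mul, (hcomm.pow_pow j _).eq, MulAut.mul_apply,
      mul_comm i j, pow_mul]

/-! ### Groups whose nontrivial elements have order p or q. -/

section Frobenius

variable {M : Type*} [Group M] {p q : ℕ} [hp : Fact p.Prime] [hq : Fact q.Prime]

theorem not_commute_of_orderOf (hpq : p ≠ q)
    (hord : ∀ x : M, x = 1 ∨ orderOf x = p ∨ orderOf x = q) {x y : M}
    (hx : orderOf x = p) (hy : orderOf y = q) : ¬ Commute x y := by
  intro h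
  have h1 := h.orderOf_mul_eq_mul_orderOf_of_coprime
    (by rw [hx, hy]; exact (Nat.coprime_primes hp.out hq.out).2 hpq)
  rw [hx, hy] at h1
  have hp1 := hp.out.one_lt
  have hq1 := hq.out.one_lt
  rcases hord (x * y) with h2 | h2 | h2
  · rw [h2, orderOf_one] at h1
    nlinarith
  · rw [h2] at h1
    nlinarith
  · rw [h2] at h1
    nlinarith

variable [Finite M] {K : Subgroup M}

/-- The $p$-group $K$ has a nontrivial central element. Automorphisms preserve $K$ and carry that
element to any other of order $p$, so all of $K$ is central in $K$. -/
theorem mul_comm_of_autTransitive (hK : ∀ x, x ∈ K ↔ x = 1 ∨ orderOf x = p)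
    (hT : AutTransitive p M) {x y : M} (hx : x ∈ K) (hy : y ∈ K) : x * y = y * x := by
  rcases (hK x).1 hx with rfl | hxp
  · simp
  have hKp : IsPGroup p K := by
    rintro ⟨k, hk⟩
    refine ⟨1, ?_⟩
    rcases (hK k).1 hk with rfl | h
    · ext; simp
    · ext; simp [← h, pow_orderOf_eq_one]
  have : Nontrivial K := ⟨⟨x, hx⟩, 1, by
    intro h
    have : x = 1 := congrArg Subtype.val h
    rw [this, orderOf_one] at hxp
    exact hp.out.one_lt.ne hxp⟩
  obtain ⟨w, hw⟩ := (nontrivial_iff_exists_ne (1 : center K)).1 hKp.center_nontrivial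
  have hwo : orderOf ((w : K) : M) = p := by
    refine ((hK _).1 (w : K).2).resolve_left fun h => hw ?_
    exact Subtype.ext (Subtype.ext h)
  obtain ⟨φ, rfl⟩ := hT _ x hwo hxp
  have hy' : φ⁻¹ y ∈ K := by
    rw [hK] at hy ⊢
    rcases hy with rfl | h
    · simp
    · right
      rw [← h]
      exact MulEquiv.orderOf_eq (φ⁻¹ : MulAut M) y
  have h1 := congrArg Subtype.val (mem_center_iff.1 w.2 ⟨φ⁻¹ y, hy'⟩)
  have h2 := congrArg φ h1
  simpa using h2.symm

variable [K.Normal]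

/-- If $Q$ exceeded $\langle w\rangle$, with $w$ central of order $q$, a further $v \in Q$ would
give commuting fixed-point-free automorphisms of $K$, forcing $a^q = 1$ for an element of order $p$.
-/
theorem card_sylow_eq_of_orderOf (hpq : p ≠ q)
    (hord : ∀ x : M, x = 1 ∨ orderOf x = p ∨ orderOf x = q)
    (hK : ∀ x, x ∈ K ↔ x = 1 ∨ orderOf x = p) (hKc : ∀ x ∈ K, ∀ y ∈ K, x * y = y * x)
    {a : M} (ha : orderOf a = p) (Q : Sylow q M) (hQ : q ∣ Nat.card M) : Nat.card Q = q := by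
  obtain ⟨w, hwo, hwQ, hwc⟩ := exists_orderOf_eq_mem_center Q hQ
  by_contra hne
  have hlt : zpowers w < (Q : Subgroup M) := by
    refine lt_of_le_of_ne (zpowers_le.2 hwQ) fun h => hne ?_
    rw [← h, Nat.card_zpowers, hwo]
  obtain ⟨v, hvQ, hvw⟩ := SetLike.exists_of_lt hlt
  have hQord : ∀ x ∈ Q, x ≠ 1 → orderOf x = q := by
    intro x hx hx1
    rcases hord x with h | h | h
    · exact absurd h hx1
    · obtain ⟨k, hk⟩ := (IsPGroup.iff_orderOf.1 Q.2) ⟨x, hx⟩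
      rw [orderOf_mk, h] at hk
      have h1 : p ∣ q ^ k := hk ▸ dvd_rfl
      exact absurd ((Nat.prime_dvd_prime_iff_eq hp.out hq.out).1 (hp.out.dvd_of_dvd_pow h1)) hpq
    · exact h
  have hfix : ∀ x ∈ Q, x ≠ 1 → ∀ k : K, MulAut.conjNormal x k = k → k = 1 := by
    intro x hx hx1 k hk
    by_contra hk1
    have hk2 : orderOf (k : M) = p :=
      ((hK k).1 k.2).resolve_left fun h => hk1 (Subtype.ext h)
    refine not_commute_of_orderOf hpq hord hk2 (hQord x hx hx1) ?_
    have h1 := congrArg Subtype.val hk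
    rw [MulAut.conjNormal_apply] at h1
    exact (mul_inv_eq_iff_eq_mul.1 h1).symm
  let _ : CommGroup K :=
    { (inferInstance : Group K) with
      mul_comm := fun x y => Subtype.ext (hKc x x.2 y y.2) }
  have hv1 : v ≠ 1 := fun h => hvw (h ▸ one_mem _)
  have hw1 : w ≠ 1 := fun h => by
    rw [h, orderOf_one] at hwo
    exact hq.out.one_lt.ne hwo
  have hpow : ∀ x ∈ Q, x ≠ 1 → (MulAut.conjNormal x : MulAut K) ^ q = 1 := by
    intro x hx hx1
    rw [← map_pow, ← hQord x hx hx1, pow_orderOf_eq_one, map_one]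
  have hcomm : Commute v w := mem_centralizer_iff.1 hwc v hvQ
  have hmain := pow_eq_one_of_fixedPointFree (K := K) hq.out (MulAut.conjNormal v)
    (MulAut.conjNormal w) (hcomm.map _) (hpow v hvQ hv1) (hpow w hwQ hw1) (hfix w hwQ hw1) (by
      intro i
      rw [← map_pow, ← map_mul]
      refine hfix _ (mul_mem hvQ (pow_mem hwQ i)) fun h => hvw ?_
      rw [eq_inv_of_mul_eq_one_left h]
      exact inv_mem (pow_mem (mem_zpowers w) i)) ⟨a, (hK a).2 (Or.inr ha)⟩
  have h1 : a ^ q = 1 := congrArg Subtype.val hmain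
  have h2 := orderOf_dvd_of_pow_eq_one h1
  rw [ha] at h2
  exact hpq ((Nat.prime_dvd_prime_iff_eq hp.out hq.out).1 h2)

theorem exists_isFrobenius (hpq : p ≠ q)
    (hord : ∀ x : M, x = 1 ∨ orderOf x = p ∨ orderOf x = q)
    (hK : ∀ x, x ∈ K ↔ x = 1 ∨ orderOf x = p) (hT : AutTransitive p M)
    {a b : M} (ha : orderOf a = p) (hb : orderOf b = q) :
    ∃ H : Subgroup M, IsFrobenius K H ∧ IsElementaryAbelian p K ∧
      Nonempty (H ≃* Multiplicative (ZMod q)) ∧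
      ∃ n : ℕ, 1 ≤ n ∧ Nat.card K = p ^ n ∧ Nat.card M = p ^ n * q := by
  have hKc : ∀ x ∈ K, ∀ y ∈ K, x * y = y * x :=
    fun x hx y hy => mul_comm_of_autTransitive hK hT hx hy
  obtain ⟨Q⟩ : Nonempty (Sylow q M) := inferInstance
  have hQ := card_sylow_eq_of_orderOf hpq hord hK hKc ha Q (hb ▸ orderOf_dvd_natCard b)
  have hQord : ∀ x ∈ Q, x ≠ 1 → orderOf x = q := by
    intro x hx hx1
    have h1 : orderOf x ∣ q := by
      have h2 := orderOf_dvd_natCard (⟨x, hx⟩ : (Q : Subgroup M))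
      rwa [orderOf_mk, hQ] at h2
    exact ((Nat.dvd_prime hq.out).1 h1).resolve_left fun h => hx1 (orderOf_eq_one_iff.1 h)
  have hdisj : ∀ x ∈ K, x ∈ Q → x = 1 := by
    intro x hxK hxQ
    by_contra hx1
    exact hpq ((((hK x).1 hxK).resolve_left hx1).symm.trans (hQord x hxQ hx1))
  have helem : IsElementaryAbelian p K := by
    refine ⟨fun x y => Subtype.ext (hKc x x.2 y y.2), fun x => Subtype.ext ?_⟩
    rcases (hK x).1 x.2 with h | h
    · simp [h]
    · simp [← h, pow_orderOf_eq_one]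
  have hKp : IsPGroup p K := fun x => ⟨1, by rw [pow_one]; exact helem.2 x⟩
  obtain ⟨n, hn⟩ := IsPGroup.iff_card.1 hKp
  have hindex : K.index = q := by
    have hq' : IsPGroup q (M ⧸ K) := by
      intro x
      induction x using QuotientGroup.induction_on with
      | H x =>
        refine ⟨1, ?_⟩
        rw [pow_one, ← QuotientGroup.mk_pow, QuotientGroup.eq_one_iff]
        rcases hord x with h | h | h
        · simp [h]
        · exact pow_mem ((hK x).2 (Or.inr h)) _
        · rw [← h, pow_orderOf_eq_one]; exact one_mem _
    obtain ⟨m, hm⟩ := IsPGroup.iff_card.1 hq'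
    have hKi : K.index = q ^ m := hm
    obtain ⟨s, hs⟩ : ∃ s, Nat.card M = q * s := hb ▸ orderOf_dvd_natCard b
    have hcop := Q.card_coprime_index
    have h1 := (Q : Subgroup M).card_mul_index
    have h2 := K.card_mul_index
    have h3 : q ^ m ∣ q * (Q : Subgroup M).index := by
      rw [← hKi, show q * (Q : Subgroup M).index = Nat.card M by rw [← h1, hQ]]
      exact K.index_dvd_card
    rw [hQ] at hcop
    have h4 : q ^ m ∣ q := (hcop.pow_left m).dvd_of_dvd_mul_right h3
    rw [hKi]
    refine Nat.dvd_antisymm h4 ?_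
    have h5 : q ∣ p ^ n * q ^ m := by
      rw [← hn, ← hKi, h2]
      exact hb ▸ orderOf_dvd_natCard b
    exact (((Nat.coprime_primes hq.out hp.out).2 hpq.symm).pow_right n).dvd_of_dvd_mul_left h5
  have hcard : Nat.card M = p ^ n * q := by rw [← K.card_mul_index, hn, hindex]
  have hcompl : K.IsComplement' (Q : Subgroup M) := by
    refine isComplement'_of_coprime ?_ ?_
    · rw [hn, hQ, hcard]
    · rw [hn, hQ]
      exact ((Nat.coprime_primes hp.out hq.out).2 hpq).pow_left n
  have haK : a ∈ K := (hK a).2 (Or.inr ha)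
  have ha1 : a ≠ 1 := fun h => hp.out.one_lt.ne (by rw [← ha, h, orderOf_one])
  refine ⟨Q, ⟨?_, ?_, ?_, ?_⟩, helem, ?_, n, ?_, hn, hcard⟩
  · intro h
    rw [h, card_bot] at hQ
    exact hq.out.one_lt.ne hQ
  · intro h
    exact ha1 (hdisj a haK (by
      change a ∈ (Q : Subgroup M)
      rw [h]; exact mem_top a))
  · intro g hg h hh hgh
    by_contra hh1
    obtain ⟨k, hkK, u, hu, rfl⟩ : ∃ k ∈ K, ∃ u ∈ (Q : Subgroup M), k * u = g := by
      obtain ⟨⟨k, u⟩, hku⟩ := hcompl.2 g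
      exact ⟨k, k.2, u, u.2, hku⟩
    have hk1 : k ≠ 1 := by
      rintro rfl
      exact hg (by simpa using hu)
    have h1 : k⁻¹ * h * k ∈ (Q : Subgroup M) := by
      have h2 := mul_mem (mul_mem hu hgh) (inv_mem hu)
      convert h2 using 1
      group
    -- This commutator lies in $K$ by normality and in $Q$ by assumption, while $K \cap Q = 1$.
    have h3 : k⁻¹ * h * k * h⁻¹ = 1 := by
      refine hdisj _ ?_ (mul_mem h1 (inv_mem hh))
      have h4 := mul_mem (inv_mem hkK) (Normal.conj_mem ‹K.Normal› k hkK h)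
      convert h4 using 1
      group
    refine not_commute_of_orderOf hpq hord (((hK k).1 hkK).resolve_left hk1)
      (hQord h hh hh1) ?_
    have h5 := mul_inv_eq_one.1 h3
    rw [mul_assoc, inv_mul_eq_iff_eq_mul] at h5
    exact h5.symm
  · intro x
    constructor
    · intro hx
      by_cases hx1 : x = 1
      · exact Or.inl hx1
      · refine Or.inr fun g hg => hx1 ?_
        have h1 : g⁻¹ * x * g ∈ K := by
          simpa using Normal.conj_mem ‹K.Normal› x hx g⁻¹
        have h2 := hdisj _ h1 hg
        rw [mul_assoc, inv_mul_eq_one] at h2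
        exact (mul_eq_right.1 h2.symm)
    · rintro (rfl | hx)
      · exact one_mem K
      · rcases hord x with h | h | h
        · exact h ▸ one_mem K
        · exact (hK x).2 (Or.inr h)
        · exfalso
          have hz : IsPGroup q (zpowers x) := by
            refine IsPGroup.iff_card.2 ⟨1, ?_⟩
            rw [Nat.card_zpowers, h, pow_one]
          obtain ⟨S, hS⟩ := hz.exists_le_sylow
          obtain ⟨g, rfl⟩ := MulAction.exists_smul_eq M Q S
          have hxS : x ∈ g • Q := hS (mem_zpowers x)
          refine hx g ?_
          have h1 := (Subgroup.mem_pointwise_smul_iff_inv_smul_mem (S := (Q : Subgroup M))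
            (a := MulAut.conj g)).1 hxS
          rw [← map_inv] at h1
          simpa using h1
  · exact ⟨mulEquivOfPrimeCardEq hQ (by simp)⟩
  · rcases n with _ | n
    · rw [pow_zero] at hn
      have := card_eq_one.1 hn
      rw [this] at haK
      exact absurd (mem_bot.1 haK) ha1
    · omega

end Frobenius

/-! ### From vertices of the graph to noncentral elements. -/

section Classes

variable {G : Type*} [Group G]

theorem mk_mem_classesIn_iff {N : Subgroup G} [N.Normal] {a : G} :
    ConjClasses.mk a ∈ classesIn N ↔ a ∈ N := by
  constructor
  · intro h
    exact h ConjClasses.mem_carrier_mk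
  · intro ha x hx
    obtain ⟨g, rfl⟩ := isConj_iff.1
      (ConjClasses.mk_eq_mk_iff_isConj.1 (ConjClasses.mem_carrier_iff_mk_eq.1 hx).symm)
    exact Normal.conj_mem ‹N.Normal› a ha g

theorem one_lt_card_carrier_iff [Finite G] {a : G} :
    1 < Nat.card (ConjClasses.mk a).carrier ↔ a ∉ center G := by
  rw [Nat.card_coe_set_eq, Set.one_lt_ncard_iff_nontrivial, ← ConjClasses.mem_noncenter,
    ← not_iff_not, not_not]
  constructor
  · intro h
    obtain ⟨b, hb, hab⟩ := ConjClasses.mk_bijOn G |>.surjOn h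
    obtain ⟨g, rfl⟩ := isConj_iff.1 (ConjClasses.mk_eq_mk_iff_isConj.1 hab)
    exact Normal.conj_mem inferInstance b hb g
  · exact fun h => (ConjClasses.mk_bijOn G).mapsTo h

theorem exists_of_card_vertex_eq_two [Finite G] {N : Subgroup G} [N.Normal]
    (h : Nat.card (Vertex N) = 2) :
    (∃ a ∈ N, a ∉ center G) ∧
    ∀ a ∈ N, a ∉ center G → ∀ b ∈ N, b ∉ center G → ¬ IsConj a b →
      ∀ x ∈ N, x ∉ center G → IsConj a x ∨ IsConj b x := by
  let v : ∀ a : G, a ∈ N → a ∉ center G → Vertex N := fun a ha hac =>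
    ⟨ConjClasses.mk a, mk_mem_classesIn_iff.2 ha, one_lt_card_carrier_iff.2 hac⟩
  constructor
  · have : Nonempty (Vertex N) := by
      rw [← not_isEmpty_iff]
      intro hE
      rw [Nat.card_of_isEmpty] at h
      exact two_ne_zero h.symm
    obtain ⟨⟨c, hcN, hc⟩⟩ := this
    obtain ⟨a, rfl⟩ := ConjClasses.exists_rep c
    exact ⟨a, mk_mem_classesIn_iff.1 hcN, one_lt_card_carrier_iff.1 hc⟩
  · intro a ha hac b hb hbc hab x hx hxc
    by_contra! hcon
    have hfin : Finite (Vertex N) := Nat.finite_of_card_ne_zero (by rw [h]; exact two_ne_zero)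
    have hinj : Function.Injective ![v a ha hac, v b hb hbc, v x hx hxc] := by
      have h1 : v a ha hac ≠ v b hb hbc := fun e =>
        hab (ConjClasses.mk_eq_mk_iff_isConj.1 (congrArg Subtype.val e))
      have h2 : v a ha hac ≠ v x hx hxc := fun e =>
        hcon.1 (ConjClasses.mk_eq_mk_iff_isConj.1 (congrArg Subtype.val e))
      have h3 : v b hb hbc ≠ v x hx hxc := fun e =>
        hcon.2 (ConjClasses.mk_eq_mk_iff_isConj.1 (congrArg Subtype.val e))
      intro i j hij
      fin_cases i <;> fin_cases j <;> simp_all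
    have h4 := Nat.card_le_card_of_injective _ hinj
    rw [h, Nat.card_fin] at h4
    omega

end Classes

/-! ### The direct product case. -/

section DirectProduct

variable {G : Type*} [Group G]

theorem orderOf_eq_of_isConj {x y : G} (h : IsConj x y) : orderOf x = orderOf y := by
  obtain ⟨g, rfl⟩ := isConj_iff.1 h
  exact (MulEquiv.orderOf_eq (MulAut.conj g) x).symm

theorem eq_of_isConj_of_mem_center {x y : G} (hy : y ∈ center G) (h : IsConj x y) : x = y := by
  obtain ⟨g, hg⟩ := isConj_iff.1 h.symm
  rw [← hg, mem_center_iff.1 hy g, mul_inv_cancel_right]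

theorem eq_one_of_pow_eq_one_of_coprime {s m : ℕ} (hsm : s.Coprime m) {x : G} (hs : x ^ s = 1)
    (hm : x ^ m = 1) : x = 1 :=
  orderOf_eq_one_iff.1
    (Nat.eq_one_of_dvd_coprimes hsm (orderOf_dvd_of_pow_eq_one hs) (orderOf_dvd_of_pow_eq_one hm))

/-- Taking $s$-th powers leaves the central elements $y^s$ and $z^s$, which are conjugate and hence
equal; coprimality recovers $y = z$. -/
theorem eq_of_isConj_mul {s m : ℕ} (hsm : s.Coprime m) {u v y z : G}
    (hu : u ^ s = 1) (hv : v ^ s = 1) (hy : y ∈ center G) (hz : z ∈ center G)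
    (hym : y ^ m = 1) (hzm : z ^ m = 1) (h : IsConj (u * y) (v * z)) : y = z := by
  have hcy : Commute u y := mem_center_iff.1 hy u
  have hcz : Commute v z := mem_center_iff.1 hz v
  have h1 := h.pow s
  rw [hcy.mul_pow, hcz.mul_pow, hu, hv, one_mul, one_mul] at h1
  have h2 := eq_of_isConj_of_mem_center (pow_mem hz s) h1
  have hc : Commute y z⁻¹ := mem_center_iff.1 (inv_mem hz) y
  refine mul_inv_eq_one.1 (eq_one_of_pow_eq_one_of_coprime hsm ?_ ?_)
  · rw [hc.mul_pow, h2, inv_pow, mul_inv_cancel]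
  · rw [hc.mul_pow, hym, inv_pow, hzm, inv_one, one_mul]

/-- A noncentral $w \in P$ with central image in the quotient has all its commutators with $P$ in
$Z(G)$. By conjugation the same holds for every noncentral element, so the quotient is abelian. A
noncentral $x^p$ would be conjugate to $x$ but of smaller order. -/
theorem isElementaryAbelian_quotient_center [Finite G] {p : ℕ} [hp : Fact p.Prime]
    (P : Subgroup G) [P.Normal] (hP : IsPGroup p P)
    (hconj : ∀ x ∈ P, x ∉ center G → ∀ y ∈ P, y ∉ center G → IsConj x y) :
    IsElementaryAbelian p (P ⧸ (center G).subgroupOf P) := by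
  by_cases htriv : Subsingleton (P ⧸ (center G).subgroupOf P)
  · exact ⟨fun _ _ => Subsingleton.elim _ _, fun _ => Subsingleton.elim _ _⟩
  rw [not_subsingleton_iff_nontrivial] at htriv
  obtain ⟨w, hw⟩ := (nontrivial_iff_exists_ne
    (1 : center (P ⧸ (center G).subgroupOf P))).1
      (hP.to_quotient ((center G).subgroupOf P)).center_nontrivial
  obtain ⟨w, hwc⟩ := w
  induction w using QuotientGroup.induction_on with
  | H w =>
  have hwG : (w : G) ∉ center G := by
    intro h
    apply hw
    exact Subtype.ext ((QuotientGroup.eq_one_iff w).2 (mem_subgroupOf.2 h))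
  have hwcomm : ∀ u : P, (w : G)⁻¹ * (u : G)⁻¹ * w * u ∈ center G := by
    intro u
    have h1 := mem_center_iff.1 hwc (u : P ⧸ (center G).subgroupOf P)
    rw [← QuotientGroup.mk_mul, ← QuotientGroup.mk_mul, QuotientGroup.eq, mem_subgroupOf] at h1
    convert h1 using 1
    simp [mul_assoc]
  constructor
  · intro x y
    induction x using QuotientGroup.induction_on with
    | H x =>
    induction y using QuotientGroup.induction_on with
    | H y =>
    rw [eq_comm, ← QuotientGroup.mk_mul, ← QuotientGroup.mk_mul, QuotientGroup.eq, mem_subgroupOf]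
    have h2 : ((((y * x)⁻¹ * (x * y) : P)) : G) = (x : G)⁻¹ * (y : G)⁻¹ * x * y := by
      simp [mul_assoc]
    rw [h2]
    by_cases hx : (x : G) ∈ center G
    · have h3 : (x : G)⁻¹ * (y : G)⁻¹ * x * y = 1 := by
        have h4 := mem_center_iff.1 hx (y : G)
        rw [mul_assoc, ← h4]
        group
      rw [h3]
      exact one_mem _
    · obtain ⟨g, hg⟩ := isConj_iff.1 (hconj w w.2 hwG x x.2 hx)
      have h3 := hwcomm ⟨g⁻¹ * y * g, by simpa using Normal.conj_mem ‹P.Normal› y y.2 g⁻¹⟩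
      have h4 := Normal.conj_mem (inferInstance : (center G).Normal) _ h3 g
      convert h4 using 1
      rw [← hg]
      group
  · intro x
    induction x using QuotientGroup.induction_on with
    | H x =>
    rw [← QuotientGroup.mk_pow, QuotientGroup.eq_one_iff, mem_subgroupOf]
    by_contra hx
    have hx1 : (x : G) ∉ center G := fun h => hx (by simpa using pow_mem h p)
    have h1 := orderOf_eq_of_isConj (hconj x x.2 hx1 _ (x ^ p).2 hx)
    rw [orderOf_coe, orderOf_coe] at h1
    obtain ⟨k, hk⟩ := IsPGroup.iff_orderOf.1 hP x
    rcases k with _ | k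
    · rw [pow_zero, orderOf_eq_one_iff] at hk
      exact hx1 (by rw [hk]; exact one_mem _)
    · rw [orderOf_pow_of_dvd hp.out.ne_zero (hk ▸ dvd_pow_self p k.succ_ne_zero)] at h1
      exact (Nat.div_lt_self (orderOf_pos x) hp.out.one_lt).ne h1.symm

theorem exists_isInternalDirectProduct [Finite G] {N : Subgroup G} [N.Normal]
    (hcl : ∀ a ∈ N, a ∉ center G → ∀ b ∈ N, b ∉ center G → ¬ IsConj a b →
      ∀ x ∈ N, x ∉ center G → IsConj a x ∨ IsConj b x)
    {p : ℕ} [hp : Fact p.Prime] {e m : ℕ} (hsm : (p ^ e).Coprime m)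
    (hG : Nat.card G = p ^ e * m) {a y : G} (haN : a ∈ N) (hac : a ∉ center G)
    (has : a ^ p ^ e = 1) (hyN : y ∈ N) (hyc : y ∈ center G) (hy1 : y ≠ 1) (hym : y ^ m = 1) :
    Odd p ∧ ∃ P Q : Subgroup G,
      IsInternalDirectProduct N P Q ∧
      IsPGroup p P ∧
      IsElementaryAbelian p (P ⧸ (center G).subgroupOf P) ∧
      Q ≤ center G ⊓ N ∧
      Nonempty (Q ≃* Multiplicative (ZMod 2)) := by
  have hmulc : ∀ z ∈ center G, a * z ∉ center G := fun z hz h =>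
    hac ((mul_mem_cancel_right hz).1 h)
  have hclass : ∀ x ∈ N, x ∉ center G → IsConj a x ∨ IsConj (a * y) x :=
    hcl a haN hac (a * y) (mul_mem haN hyN) (hmulc y hyc) fun h => hy1
      (eq_of_isConj_mul hsm has has (one_mem _) hyc (one_pow m) hym (by rwa [mul_one])).symm
  have hcent : ∀ z ∈ N, z ∈ center G → z ^ m = 1 → z = 1 ∨ z = y := by
    intro z hzN hzc hzm
    rcases hclass (a * z) (mul_mem haN hzN) (hmulc z hzc) with h | h
    · exact Or.inl
        (eq_of_isConj_mul hsm has has (one_mem _) hzc (one_pow m) hzm (by rwa [mul_one])).symm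
    · exact Or.inr (eq_of_isConj_mul hsm has has hyc hzc hym hzm h).symm
  have hyy : y * y = 1 := by
    rcases hcent (y * y) (mul_mem hyN hyN) (mul_mem hyc hyc)
      (by rw [← pow_two, ← pow_mul, mul_comm, pow_mul, hym, one_pow]) with h | h
    · exact h
    · exact absurd (mul_eq_left.1 h) hy1
  have hyo : orderOf y = 2 := orderOf_eq_prime (by rw [pow_two, hyy]) hy1
  have h2m : 2 ∣ m := hyo ▸ orderOf_dvd_of_pow_eq_one hym
  have he : e ≠ 0 := by
    rintro rfl
    rw [pow_zero, pow_one] at has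
    exact hac (has ▸ one_mem _)
  have hpm : p.Coprime m := (Nat.coprime_pow_left_iff (Nat.pos_of_ne_zero he) p m).1 hsm
  have hp2 : p.Coprime 2 := hpm.coprime_dvd_right h2m
  have hodd : Odd p := Nat.coprime_two_right.1 hp2
  refine ⟨hodd, ?_⟩
  have hpart : ∀ x ∈ N, x ^ p ^ e = 1 ∨ (x * y) ^ p ^ e = 1 := by
    intro x hx
    have hxy : Commute x y := mem_center_iff.1 hyc x
    by_cases hxc : x ∈ center G
    · have h1 : (x ^ p ^ e) ^ m = 1 := by rw [← pow_mul, ← hG, pow_card_eq_one']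
      rcases hcent _ (pow_mem hx _) (pow_mem hxc _) h1 with h | h
      · exact Or.inl h
      · right
        -- The exponent is odd and $y$ is an involution.
        have h2 : y ^ p ^ e = y := by
          rw [← pow_mod_orderOf, hyo, Nat.odd_iff.1 hodd.pow, pow_one]
        rw [hxy.mul_pow, h, h2, hyy]
    · rcases hclass x hx hxc with h | h
      · left
        rw [← orderOf_dvd_iff_pow_eq_one, ← orderOf_eq_of_isConj h]
        exact orderOf_dvd_of_pow_eq_one has
      · right
        have h1 : IsConj a (x * y) := by
          obtain ⟨g, rfl⟩ := isConj_iff.1 h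
          refine isConj_iff.2 ⟨g, ?_⟩
          have h2 := mem_center_iff.1 hyc g⁻¹
          calc g * a * g⁻¹ = g * a * (y * y) * g⁻¹ := by rw [hyy, mul_one]
            _ = g * (a * y) * (y * g⁻¹) := by group
            _ = g * (a * y) * g⁻¹ * y := by rw [← h2]; group
        rw [← orderOf_dvd_iff_pow_eq_one, ← orderOf_eq_of_isConj h1]
        exact orderOf_dvd_of_pow_eq_one has
  let Y : Subgroup N := zpowers ⟨y, hyN⟩
  have hYc : Y ≤ center N := by
    rw [zpowers_le, mem_center_iff]
    exact fun g => Subtype.ext (mem_center_iff.1 hyc g)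
  have hYn : Y.Normal := ⟨fun n hn g => by
    rwa [mem_center_iff.1 (hYc hn) g, mul_inv_cancel_right]⟩
  have hYcard : Nat.card Y = 2 := by
    rw [Nat.card_zpowers, ← orderOf_coe, hyo]
  have hquot : IsPGroup p (N ⧸ Y) := by
    intro x
    induction x using QuotientGroup.induction_on with
    | H x =>
    refine ⟨e, ?_⟩
    rcases hpart x x.2 with h | h
    · rw [← QuotientGroup.mk_pow, show x ^ p ^ e = 1 from Subtype.ext h, QuotientGroup.mk_one]
    · have h1 : (x : N ⧸ Y) = ((x * ⟨y, hyN⟩ : N) : N ⧸ Y) := by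
        rw [QuotientGroup.eq, inv_mul_cancel_left]
        exact mem_zpowers _
      rw [h1, ← QuotientGroup.mk_pow,
        show (x * ⟨y, hyN⟩) ^ p ^ e = 1 from Subtype.ext h, QuotientGroup.mk_one]
  obtain ⟨n, hn⟩ := IsPGroup.iff_card.1 hquot
  have hYi : Y.index = p ^ n := hn
  -- Schur–Zassenhaus: $|Y| = 2$ and its index is a power of the odd prime $p$.
  obtain ⟨H, hH⟩ := exists_left_complement'_of_coprime (N := Y)
    (by rw [hYcard, hYi]; exact (hp2.pow_left n).symm)
  have hHcard : Nat.card H = p ^ n := by rw [← hYi, hH.index_eq_card]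
  have hHp : IsPGroup p H := IsPGroup.iff_card.2 ⟨n, hHcard⟩
  let P : Subgroup G := H.map N.subtype
  let Q : Subgroup G := Y.map N.subtype
  have hPp : IsPGroup p P := hHp.map _
  have hPs : ∀ x ∈ P, x ^ p ^ e = 1 := by
    intro x hx
    obtain ⟨k, hk⟩ := hPp ⟨x, hx⟩
    have h1 : x ^ p ^ k = 1 := congrArg Subtype.val hk
    refine eq_one_of_pow_eq_one_of_coprime (hpm.pow_left k) ?_ ?_
    · rw [← pow_mul, mul_comm, pow_mul, h1, one_pow]
    · rw [← pow_mul, ← hG, pow_card_eq_one']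
  have hQ : Q = zpowers y := by
    change (zpowers _).map _ = _
    rw [MonoidHom.map_zpowers]
    rfl
  have hQc : Q ≤ center G := by rw [hQ, zpowers_le]; exact hyc
  have hsup : P ⊔ Q = N := by
    change H.map _ ⊔ Y.map _ = N
    rw [← Subgroup.map_sup, hH.sup_eq_top, ← MonoidHom.range_eq_map, N.range_subtype]
  have hPN : P ≤ N := hsup ▸ le_sup_left
  have hQN : Q ≤ N := hsup ▸ le_sup_right
  -- $P$ is the set of all $p$-elements of $N$, which makes it normal in $G$.
  have hPmem : ∀ x ∈ N, x ^ p ^ e = 1 → x ∈ P := by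
    intro x hx hxs
    obtain ⟨⟨h, k⟩, hhk⟩ := hH.2 (⟨x, hx⟩ : N)
    have hxhk : ((h : N) : G) * ((k : N) : G) = x := congrArg Subtype.val hhk
    have hhP : ((h : N) : G) ∈ P := ⟨h, h.2, rfl⟩
    have hkQ : ((k : N) : G) ∈ Q := ⟨k, k.2, rfl⟩
    have hk1 : ((k : N) : G) = 1 := by
      have h1 : Commute ((h : N) : G) ((k : N) : G) := mem_center_iff.1 (hQc hkQ) _
      have h2 := h1.mul_pow (p ^ e)
      rw [hxhk, hxs, hPs _ hhP, one_mul] at h2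
      refine eq_one_of_pow_eq_one_of_coprime hsm h2.symm ?_
      rw [hQ] at hkQ
      rw [← orderOf_dvd_iff_pow_eq_one]
      exact (orderOf_dvd_of_mem_zpowers hkQ).trans (orderOf_dvd_of_pow_eq_one hym)
    rw [← hxhk, hk1, mul_one]
    exact hhP
  have hPn : P.Normal := ⟨fun x hx g => hPmem _ (Normal.conj_mem ‹N.Normal› x (hPN hx) g) (by
    rw [conj_pow, hPs x hx, mul_one, mul_inv_cancel])⟩
  have hPa : ∀ x ∈ P, x ∉ center G → IsConj a x := by
    intro x hx hxc
    refine (hclass x (hPN hx) hxc).resolve_right fun h => hy1 ?_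
    exact eq_of_isConj_mul hsm has (hPs x hx) hyc (one_mem _) hym (one_pow m) (by rwa [mul_one])
  refine ⟨P, Q, ⟨?_, hsup, ?_⟩, hPp, ?_, le_inf hQc hQN, ?_⟩
  · change H.map _ ⊓ Y.map _ = ⊥
    rw [← map_inf_eq _ _ _ N.subtype_injective, hH.disjoint.eq_bot, Subgroup.map_bot]
  · intro x _ z hz
    exact mem_center_iff.1 (hQc hz) x
  · exact isElementaryAbelian_quotient_center P hPp
      fun x hx hxc z hz hzc => (hPa x hx hxc).symm.trans (hPa z hz hzc)
  · rw [hQ]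
    have : Fact (Nat.Prime 2) := ⟨Nat.prime_two⟩
    exact ⟨mulEquivOfPrimeCardEq (p := 2) (by rw [Nat.card_zpowers, hyo]) (by simp)⟩

end DirectProduct

/-! ### The Frobenius case inside G, and the choice of prime power elements. -/

variable {G : Type*} [Group G]

theorem autTransitive_of_isConj {N : Subgroup G} [N.Normal] {p q : ℕ}
    (hp : p ≠ 1) (hpq : p ≠ q) {a b : G} (hb : orderOf b = q)
    (hcl : ∀ x ∈ N, x = 1 ∨ IsConj a x ∨ IsConj b x) : AutTransitive p N := by
  have key : ∀ x : N, orderOf x = p → IsConj a x := by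
    intro x hx
    rw [← orderOf_coe] at hx
    rcases hcl x x.2 with h | h | h
    · rw [h, orderOf_one] at hx
      exact absurd hx.symm hp
    · exact h
    · rw [← orderOf_eq_of_isConj h, hb] at hx
      exact absurd hx.symm hpq
  intro x y hx hy
  obtain ⟨g, hg⟩ := isConj_iff.1 ((key x hx).symm.trans (key y hy))
  exact ⟨MulAut.conjNormal g, Subtype.ext (by rw [MulAut.conjNormal_apply, hg])⟩

variable [Finite G]

theorem image_card_classesIn {N : Subgroup G} [N.Normal] {p q n : ℕ} (hp : p.Prime) (hq : q.Prime)
    (hpq : p ≠ q) {K : Subgroup N} {a b : G} (haN : a ∈ N) (hbN : b ∈ N)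
    (ha : orderOf a = p) (hb : orderOf b = q)
    (hcl : ∀ x ∈ N, x = 1 ∨ IsConj a x ∨ IsConj b x)
    (hK : ∀ x, x ∈ K ↔ x = 1 ∨ orderOf x = p) (hKcard : Nat.card K = p ^ n)
    (hNcard : Nat.card N = p ^ n * q) :
    (fun c : ConjClasses G => Nat.card c.carrier) '' classesIn N
      = {1, p ^ n - 1, p ^ n * (q - 1)} := by
  have hmem : ∀ x y : G, x ∈ (ConjClasses.mk y).carrier ↔ IsConj y x := fun x y => by
    rw [ConjClasses.mem_carrier_iff_mk_eq, ConjClasses.mk_eq_mk_iff_isConj, isConj_comm]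
  have hN : ∀ {x y : G}, y ∈ N → IsConj y x → x ∈ N := by
    intro x y hy h
    obtain ⟨g, rfl⟩ := isConj_iff.1 h
    exact Normal.conj_mem ‹N.Normal› y hy g
  have h1 : Nat.card (ConjClasses.mk (1 : G)).carrier = 1 := by
    rw [Nat.card_coe_set_eq, Set.ncard_eq_one]
    refine ⟨1, Set.ext fun x => ?_⟩
    rw [hmem, isConj_one_right, Set.mem_singleton_iff]
  have h2 : Nat.card (ConjClasses.mk a).carrier = p ^ n - 1 := by
    have e : (ConjClasses.mk a).carrier = N.subtype '' ((K : Set N) \ {1}) := by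
      ext x
      rw [hmem]
      constructor
      · intro h
        have hxo := (orderOf_eq_of_isConj h).symm.trans ha
        have hxN := hN haN h
        refine ⟨⟨x, hxN⟩, ⟨(hK _).2 (Or.inr (by rwa [orderOf_mk])), fun h1 => ?_⟩, rfl⟩
        have h3 : x = 1 := congrArg Subtype.val h1
        rw [h3, orderOf_one] at hxo
        exact hp.one_lt.ne hxo
      · rintro ⟨x, ⟨hx, hx1⟩, rfl⟩
        have hxo := ((hK x).1 hx).resolve_left hx1
        rcases hcl x x.2 with h | h | h
        · exact absurd (Subtype.ext h) hx1
        · exact h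
        · have h3 := orderOf_eq_of_isConj h
          rw [hb, orderOf_coe, hxo] at h3
          exact absurd h3.symm hpq
    rw [Nat.card_coe_set_eq, e, Set.ncard_image_of_injective _ N.subtype_injective,
      Set.ncard_sdiff_singleton_of_mem (one_mem K), ← Nat.card_coe_set_eq]
    exact congrArg (· - 1) hKcard
  have h3 : Nat.card (ConjClasses.mk b).carrier = p ^ n * (q - 1) := by
    have e : (ConjClasses.mk b).carrier = N.subtype '' ((K : Set N)ᶜ) := by
      ext x
      rw [hmem]
      constructor
      · intro h
        have hxo := (orderOf_eq_of_isConj h).symm.trans hb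
        refine ⟨⟨x, hN hbN h⟩, fun h1 => ?_, rfl⟩
        rcases (hK _).1 h1 with h2 | h2
        · have h3 : x = 1 := congrArg Subtype.val h2
          rw [h3, orderOf_one] at hxo
          exact hq.one_lt.ne hxo
        · rw [orderOf_mk, hxo] at h2
          exact hpq h2.symm
      · rintro ⟨x, hx, rfl⟩
        rcases hcl x x.2 with h | h | h
        · exact absurd ((hK x).2 (Or.inl (Subtype.ext h))) hx
        · refine absurd ((hK x).2 (Or.inr ?_)) hx
          rw [← orderOf_coe, ← orderOf_eq_of_isConj h, ha]
        · exact h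
    rw [Nat.card_coe_set_eq, e, Set.ncard_image_of_injective _ N.subtype_injective,
      Set.ncard_compl, ← Nat.card_coe_set_eq, hNcard, mul_tsub, mul_one]
    exact congrArg (p ^ n * q - ·) hKcard
  ext k
  simp only [Set.mem_image, Set.mem_insert_iff, Set.mem_singleton_iff]
  constructor
  · rintro ⟨c, hc, rfl⟩
    obtain ⟨x, rfl⟩ := ConjClasses.exists_rep c
    rcases hcl x (mk_mem_classesIn_iff.1 hc) with rfl | h | h
    · exact Or.inl h1
    · rw [← ConjClasses.mk_eq_mk_iff_isConj.2 h]
      exact Or.inr (Or.inl h2)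
    · rw [← ConjClasses.mk_eq_mk_iff_isConj.2 h]
      exact Or.inr (Or.inr h3)
  · rintro (rfl | rfl | rfl)
    · exact ⟨_, mk_mem_classesIn_iff.2 (one_mem N), h1⟩
    · exact ⟨_, mk_mem_classesIn_iff.2 haN, h2⟩
    · exact ⟨_, mk_mem_classesIn_iff.2 hbN, h3⟩

theorem exists_isFrobenius_of_isConj {N : Subgroup G} [N.Normal] {p q : ℕ} [hp : Fact p.Prime]
    [hq : Fact q.Prime] (hpq : p ≠ q) {a b : G} (haN : a ∈ N) (hbN : b ∈ N)
    (ha : orderOf a = p) (hb : orderOf b = q)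
    (hcl : ∀ x ∈ N, x = 1 ∨ IsConj a x ∨ IsConj b x) :
    ∃ p q : ℕ, p.Prime ∧ q.Prime ∧ p ≠ q ∧ ∃ K H : Subgroup N,
      IsFrobenius K H ∧
      IsElementaryAbelian p K ∧
      Nonempty (H ≃* Multiplicative (ZMod q)) ∧
      ∃ a : ℕ, 1 ≤ a ∧ Nat.card N = p ^ a * q ∧
        (fun c : ConjClasses G => Nat.card c.carrier) '' classesIn N
          = {1, p ^ a - 1, p ^ a * (q - 1)} := by
  have hcl' : ∀ x ∈ N, x = 1 ∨ IsConj b x ∨ IsConj a x := fun x hx => (hcl x hx).imp_right Or.symm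
  have hord : ∀ x : N, x = 1 ∨ orderOf x = p ∨ orderOf x = q := by
    intro x
    rcases hcl x x.2 with h | h | h
    · exact Or.inl (Subtype.ext h)
    · rw [← orderOf_coe, ← orderOf_eq_of_isConj h]
      exact Or.inr (Or.inl ha)
    · rw [← orderOf_coe, ← orderOf_eq_of_isConj h]
      exact Or.inr (Or.inr hb)
  have hTp : AutTransitive p N := autTransitive_of_isConj hp.out.ne_one hpq hb hcl
  have hTq : AutTransitive q N := autTransitive_of_isConj hq.out.ne_one hpq.symm ha hcl'
  have haN' : orderOf (⟨a, haN⟩ : N) = p := by rwa [orderOf_mk]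
  have hbN' : orderOf (⟨b, hbN⟩ : N) = q := by rwa [orderOf_mk]
  rcases exists_normal_mem_iff_orderOf_eq hpq hord hTp hTq with ⟨K, _, hK⟩ | ⟨K, _, hK⟩
  · obtain ⟨H, hF, hE, hH, n, hn, hKn, hNn⟩ := exists_isFrobenius hpq hord hK hTp haN' hbN'
    exact ⟨p, q, hp.out, hq.out, hpq, K, H, hF, hE, hH, n, hn, hNn,
      image_card_classesIn hp.out hq.out hpq haN hbN ha hb hcl hK hKn hNn⟩
  · obtain ⟨H, hF, hE, hH, n, hn, hKn, hNn⟩ := exists_isFrobenius hpq.symm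
      (fun x => (hord x).imp_right Or.symm) hK hTq hbN' haN'
    exact ⟨q, p, hq.out, hp.out, hpq.symm, K, H, hF, hE, hH, n, hn, hNn,
      image_card_classesIn hq.out hp.out hpq.symm hbN haN hb ha hcl' hK hKn hNn⟩

/-- Take a noncentral $a \in N$ of least order. Its $d$-th power is central for each prime $d$
dividing the order, so two such primes would make the image of $a$ in $G/Z(G)$ trivial. -/
theorem exists_orderOf_eq_prime_pow_notMem_center {N : Subgroup G}
    (h : ∃ a ∈ N, a ∉ center G) :
    ∃ p : ℕ, p.Prime ∧ ∃ k : ℕ, ∃ a ∈ N, a ∉ center G ∧ orderOf a = p ^ k := by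
  obtain ⟨a, ⟨haN, hac⟩, hmin⟩ := exists_minimalFor_of_wellFoundedLT
    (fun a => a ∈ N ∧ a ∉ center G) (orderOf : G → ℕ) h
  have hpow : ∀ d : ℕ, d.Prime → d ∣ orderOf a → a ^ d ∈ center G := by
    intro d hd hda
    by_contra hac'
    have h1 : orderOf (a ^ d) < orderOf a := by
      rw [orderOf_pow_of_dvd hd.ne_zero hda]
      exact Nat.div_lt_self (orderOf_pos a) hd.one_lt
    exact h1.not_ge (hmin ⟨pow_mem haN d, hac'⟩ h1.le)
  have ha1 : orderOf a ≠ 1 := fun h => hac (orderOf_eq_one_iff.1 h ▸ one_mem _)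
  obtain ⟨p, hp, hpa⟩ := Nat.exists_prime_and_dvd ha1
  refine ⟨p, hp, _, a, haN, hac, Nat.eq_prime_pow_of_unique_prime_dvd (orderOf_pos a).ne' ?_⟩
  intro d hd hda
  by_contra hdp
  refine hac ((QuotientGroup.eq_one_iff a).1 (eq_one_of_pow_eq_one_of_coprime
    ((Nat.coprime_primes hd hp).2 hdp) ?_ ?_))
  · rw [← QuotientGroup.mk_pow, QuotientGroup.eq_one_iff]
    exact hpow d hd hda
  · rw [← QuotientGroup.mk_pow, QuotientGroup.eq_one_iff]
    exact hpow p hp hpa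

theorem exists_prime_orderOf_of_not_isPGroup {N : Subgroup G} {p : ℕ} [Fact p.Prime]
    (h : ¬ IsPGroup p N) : ∃ q : ℕ, q.Prime ∧ q ≠ p ∧ ∃ b ∈ N, orderOf b = q := by
  by_contra! hcon
  apply h
  refine IsPGroup.iff_card.2 ⟨_, Nat.eq_prime_pow_of_unique_prime_dvd Nat.card_pos.ne' ?_⟩
  intro d hd hdvd
  by_contra hdp
  have : Fact d.Prime := ⟨hd⟩
  obtain ⟨b, hb⟩ := exists_prime_orderOf_dvd_card' (G := N) d hdvd
  exact hcon d hd hdp b b.2 (by rwa [orderOf_coe])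

end NormalClassGraph

/-! ### The case distinction. -/

open NormalClassGraph

theorem theorem4p2p2 {G : Type*} [Group G] [Finite G] (N : Subgroup G) [N.Normal]
    (hvertices : Nat.card (NormalClassGraph.Vertex N) = 2)
    (hedges : (NormalClassGraph.graph N).edgeSet.ncard = 1) :
    (∃ p : ℕ, p.Prime ∧ IsPGroup p N) ∨
    (∃ p : ℕ, p.Prime ∧ Odd p ∧ ∃ P Q : Subgroup G,
      NormalClassGraph.IsInternalDirectProduct N P Q ∧
      IsPGroup p P ∧
      NormalClassGraph.IsElementaryAbelian p (P ⧸ (Subgroup.center G).subgroupOf P) ∧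
      Q ≤ Subgroup.center G ⊓ N ∧
      Nonempty (Q ≃* Multiplicative (ZMod 2))) ∨
    (∃ p q : ℕ, p.Prime ∧ q.Prime ∧ p ≠ q ∧ ∃ K H : Subgroup N,
      NormalClassGraph.IsFrobenius K H ∧
      NormalClassGraph.IsElementaryAbelian p K ∧
      Nonempty (H ≃* Multiplicative (ZMod q)) ∧
      ∃ a : ℕ, 1 ≤ a ∧ Nat.card N = p ^ a * q ∧
        (fun c : ConjClasses G => Nat.card c.carrier) '' NormalClassGraph.classesIn N
          = {1, p ^ a - 1, p ^ a * (q - 1)}) := by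
  obtain ⟨hne, hcl⟩ := exists_of_card_vertex_eq_two hvertices
  by_cases h1 : ∃ p : ℕ, p.Prime ∧ IsPGroup p N
  · exact Or.inl h1
  right
  -- The two power conditions say that $a$ is a $p$-element and $y$ a $p'$-element.
  by_cases h2 : ∃ p : ℕ, p.Prime ∧ (∃ a ∈ N, a ∉ Subgroup.center G ∧
      a ^ p ^ (Nat.card G).factorization p = 1) ∧
      ∃ y ∈ N, y ∈ Subgroup.center G ∧ y ≠ 1 ∧
        y ^ (Nat.card G / p ^ (Nat.card G).factorization p) = 1
  · left
    obtain ⟨p, hp, ⟨a, haN, hac, has⟩, y, hyN, hyc, hy1, hym⟩ := h2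
    have : Fact p.Prime := ⟨hp⟩
    exact ⟨p, hp, exists_isInternalDirectProduct hcl
      ((Nat.coprime_ordCompl hp Nat.card_pos.ne').pow_left _)
      (Nat.ordProj_mul_ordCompl_eq_self _ _).symm haN hac has hyN hyc hy1 hym⟩
  right
  push Not at h1 h2
  have hsylow : ∀ {p k : ℕ} {x : G}, p.Prime → orderOf x = p ^ k →
      x ^ p ^ (Nat.card G).factorization p = 1 := by
    intro p k x hp hx
    rw [← orderOf_dvd_iff_pow_eq_one, hx]
    refine pow_dvd_pow p ((hp.pow_dvd_iff_le_factorization Nat.card_pos.ne').1 ?_)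
    rw [← hx]
    exact orderOf_dvd_natCard x
  have hhall : ∀ {p q : ℕ} {x : G}, p.Prime → q.Prime → q ≠ p →
      x ^ q ^ (Nat.card G).factorization q = 1 →
      x ^ (Nat.card G / p ^ (Nat.card G).factorization p) = 1 := by
    intro p q x hp hq hqp hx
    rw [← orderOf_dvd_iff_pow_eq_one] at hx ⊢
    refine Nat.Coprime.dvd_of_dvd_mul_left (k := orderOf x)
      (m := p ^ (Nat.card G).factorization p) ?_ ?_
    · exact Nat.Coprime.coprime_dvd_left hx (((Nat.coprime_primes hq hp).2 hqp).pow _ _)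
    · rw [Nat.ordProj_mul_ordCompl_eq_self]
      exact orderOf_dvd_natCard x
  obtain ⟨p, hp, k, a, haN, hac, hak⟩ := exists_orderOf_eq_prime_pow_notMem_center hne
  have : Fact p.Prime := ⟨hp⟩
  have has := hsylow hp hak
  obtain ⟨q, hq, hqp, b, hbN, hb⟩ := exists_prime_orderOf_of_not_isPGroup (h1 p hp)
  have : Fact q.Prime := ⟨hq⟩
  have hbs := hsylow hq (hb.trans (pow_one q).symm)
  have hb1 : b ≠ 1 := fun h => hq.one_lt.ne (by rw [← hb, h, orderOf_one])
  have hbc : b ∉ Subgroup.center G := fun h =>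
    h2 p hp ⟨a, haN, hac, has⟩ b hbN h hb1 (hhall hp hq hqp hbs)
  -- The pair $(p, a)$ kills the $p'$-part of $z$; then $z$ is a $p$-element, hence a $q'$-element,
  -- and the pair $(q, b)$ kills it.
  have hcenter : ∀ z ∈ N, z ∈ Subgroup.center G → z = 1 := by
    intro z hzN hzc
    have hzs : z ^ p ^ (Nat.card G).factorization p = 1 := by
      by_contra hz
      refine h2 p hp ⟨a, haN, hac, has⟩ _ (pow_mem hzN _) (pow_mem hzc _) hz ?_
      rw [← pow_mul, Nat.ordProj_mul_ordCompl_eq_self, pow_card_eq_one']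
    by_contra hz
    exact h2 q hq ⟨b, hbN, hbc, hbs⟩ z hzN hzc hz (hhall hq hp hqp.symm hzs)
  have hpN : p ∣ Nat.card N := by
    have hk : k ≠ 0 := by
      rintro rfl
      rw [pow_zero, orderOf_eq_one_iff] at hak
      exact hac (hak ▸ one_mem _)
    have h3 := orderOf_dvd_natCard (⟨a, haN⟩ : N)
    rw [Subgroup.orderOf_mk, hak] at h3
    exact (dvd_pow_self p hk).trans h3
  obtain ⟨⟨c, hcN⟩, hc⟩ := exists_prime_orderOf_dvd_card' (G := N) p hpN
  rw [Subgroup.orderOf_mk] at hc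
  have hcc : c ∉ Subgroup.center G := fun h => hp.one_lt.ne (by
    rw [← hc, hcenter c hcN h, orderOf_one])
  refine exists_isFrobenius_of_isConj hqp.symm hcN hbN hc hb fun x hx => ?_
  by_cases hxc : x ∈ Subgroup.center G
  · exact Or.inl (hcenter x hx hxc)
  · refine Or.inr (hcl c hcN hcc b hbN hbc (fun h => hqp ?_) x hx hxc)
    rw [← hb, ← orderOf_eq_of_isConj h, hc]
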